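/- Let $D, M, N$ be natural numbers with $N \ge 1$, let $T \ge 0$ and $\delta t = T/N$. Let $H^{(0)}, H^{(1)}, \dots, H^{(M)}$ be Hermitian operators on $\mathcal H = \mathbb C^D$, and suppose that the control Hamiltonians $H^{(1)}, \dots, H^{(M)}$ have a common spectral width $\lambda_{\max}(H^{(\mu)}) - \lambda_{\min}(H^{(\mu)}) = \omega_{\max}$ (for a single control, $M = 1$, this just defines $\omega_{\max}$). For piecewise-constant controls $u = (u_{\mu\nu}) \in \mathbb R^{M \times N}$ put $$U(u) = U_N(u) \cdots U_1(u), \qquad U_\nu(u) = \exp\Big(-i\,\delta t\,\big(H^{(0)} + \sum_{\mu=1}^M u_{\mu\nu} H^{(\mu)}\big)\Big).$$ Let $\psi \in \mathcal H$ be a unit vector. For a Hermitian operator $O$ on $\mathcal H$ define the landscape $J_O(u) = \langle \psi | U(u)^\dagger\, O\, U(u) | \psi \rangle$ and $\Delta O = \max_{\|\varphi\|=1} \langle\varphi|O|\varphi\rangle - \min_{\|\varphi\|=1} \langle\varphi|O|\varphi\rangle$. (a) For every Hermitian $O$ the function $J_O : \mathbb R^{M\times N} \to \mathbb R$ is infinitely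 differentiable, and for every $P \ge 1$, all indices $(\mu_1,\nu_1), \dots, (\mu_P,\nu_P)$ (repetitions allowed) and all $u \in \mathbb R^{M \times N}$, $$\left| \partial_{\mu_1\nu_1} \cdots \partial_{\mu_P\nu_P} J_O(u) \right| \le (\omega_{\max}\,\delta t)^P\, \frac{\Delta O}{2}.$$ (b) (State fidelity.) Let $O = |\chi\rangle\langle\chi|$ with a unit vector $\chi \in \mathcal H$. If $D \ge 2$, then $\Delta O = 1$. For every $D$, every $P \ge 1$, all indices and all $u$, $$\left| \partial_{\mu_1\nu_1} \cdots \partial_{\mu_P\nu_P} J_O(u) \right| \le \frac{(\omega_{\max}\,\delta t)^P}{2}.$$ -/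

import Mathlib

/-- The Hilbert space `ℂ^D` of a `D`-dimensional quantum system. -/
abbrev QState (D : ℕ) : Type := EuclideanSpace ℂ (Fin D)

/-- The operators on `ℂ^D`; multiplication is composition. -/
abbrev QOp (D : ℕ) : Type := QState D →L[ℂ] QState D

/-- The expectation value `⟨ψ|A|ψ⟩` of an operator. It is defined as the real part, so that it is a
real number; for a Hermitian `A` nothing is lost, see `expectation_eq_inner`. -/
noncomputable def expectation {D : ℕ} (A : QOp D) (ψ : QState D) : ℝ :=
  (inner ℂ ψ (A ψ)).re

/-- For a Hermitian operator the expectation value is the full complex number `⟨ψ|A|ψ⟩`. -/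
theorem expectation_eq_inner {D : ℕ} {A : QOp D} (hA : IsSelfAdjoint A) (ψ : QState D) :
    ((expectation A ψ : ℝ) : ℂ) = inner ℂ ψ (A ψ) := by
  have h := ContinuousLinearMap.isSelfAdjoint_iff_isSymmetric.mp hA
  have h2 : (starRingEnd ℂ) (inner ℂ ψ (A ψ)) = inner ℂ ψ (A ψ) := by
    rw [inner_conj_symm]
    exact h ψ ψ
  exact Complex.conj_eq_iff_re.mp h2

/-- The set of the values `⟨φ|A|φ⟩` over all normalized states `φ`. -/
def expectationValues {D : ℕ} (A : QOp D) : Set ℝ :=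
  {x | ∃ φ : QState D, ‖φ‖ = 1 ∧ expectation A φ = x}

/-- The range `ΔA = (max - min) ⟨φ|A|φ⟩` over all normalized states `φ`. -/
noncomputable def expectationRange {D : ℕ} (A : QOp D) : ℝ :=
  sSup (expectationValues A) - sInf (expectationValues A)

/-- The set of the real eigenvalues of an operator (all of its eigenvalues, if it is Hermitian). -/
def realEigenvalues {D : ℕ} (A : QOp D) : Set ℝ :=
  {l | Module.End.HasEigenvalue (A : QState D →ₗ[ℂ] QState D) (l : ℂ)}

/-- The spectral width `λ_max - λ_min` of a Hermitian operator. -/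
noncomputable def spectralWidth {D : ℕ} (A : QOp D) : ℝ :=
  sSup (realEigenvalues A) - sInf (realEigenvalues A)

/-- The length `δt = T / N` of one of `N` equal time steps. -/
noncomputable def timeStep (T : ℝ) (N : ℕ) : ℝ := T / N

/-- The controlled Hamiltonian `H⁽⁰⁾ + ∑ μ, u μ • H⁽μ⁾`. -/
noncomputable def hamiltonian {D M : ℕ} (H₀ : QOp D) (H : Fin M → QOp D) (u : Fin M → ℝ) : QOp D :=
  H₀ + ∑ μ, (u μ : ℂ) • H μ

/-- The propagator `exp (-i δt H(u))` of one time step, with constant controls `u`. -/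
noncomputable def stepUnitary {D M : ℕ} (H₀ : QOp D) (H : Fin M → QOp D) (δt : ℝ)
    (u : Fin M → ℝ) : QOp D :=
  NormedSpace.exp ((-(Complex.I * (δt : ℂ))) • hamiltonian H₀ H u)

/-- The propagator `U(u_N) ⋯ U(u_1)` of the piecewise-constant controls `u`, where `u (μ, ν)` is the
value of the control `μ` in the time step `ν`. The propagator of the first step acts first. -/
noncomputable def evolution {D M N : ℕ} (H₀ : QOp D) (H : Fin M → QOp D) (T : ℝ)
    (u : Fin M × Fin N → ℝ) : QOp D :=
  (List.ofFn fun ν : Fin N =>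
    stepUnitary H₀ H (timeStep T N) (fun μ => u (μ, ν))).reverse.prod

/-- The landscape `J(u) = ⟨ψ|U(u)† O U(u)|ψ⟩`. -/
noncomputable def landscape {D M N : ℕ} (H₀ : QOp D) (H : Fin M → QOp D) (T : ℝ) (O : QOp D)
    (ψ : QState D) (u : Fin M × Fin N → ℝ) : ℝ :=
  expectation (ContinuousLinearMap.adjoint (evolution H₀ H T u) * O * evolution H₀ H T u) ψ

/-- The partial derivative of a function of the coordinates `ι` with respect to the coordinate
`i`. -/
noncomputable def partialDeriv {ι : Type} [DecidableEq ι] (i : ι) (f : (ι → ℝ) → ℝ) :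
    (ι → ℝ) → ℝ :=
  fun u => lineDeriv ℝ f u (Pi.single i 1)

/-- The mixed partial derivative `∂_{i_1} ⋯ ∂_{i_P} f` for a list `[i_1, …, i_P]` of coordinates,
in which coordinates may be repeated. -/
noncomputable def mixedPartial {ι : Type} [DecidableEq ι] (is : List ι) (f : (ι → ℝ) → ℝ) :
    (ι → ℝ) → ℝ :=
  is.foldr partialDeriv f

/-!
The bound on all mixed partial derivatives follows from the same bound on all iterated finite
differences ("increments") of the landscape, and the latter needs no calculus. The predicate
`BoundedIncrements f C a` says that the increments of `f` along coordinates `iₖ` with steps `sₖ` are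
at most `C ∏ₖ a iₖ |sₖ|`. It passes to pointwise limits (`BoundedIncrements.of_tendsto`), hence to
partial derivatives of smooth functions (`BoundedIncrements.mixedPartial`), and the discrete Leibniz
rule shows that under products the constants `C` multiply and the rates `a` add
(`BoundedIncrements.mul`).

For skew-adjoint `X` the function `u ↦ exp (uᵢ X)` has `C = 1` and the rate `‖X‖` in the coordinate
`i`, because an increment multiplies it by `exp (s X) - 1`. As rates add under products, the Lie
product formula `exp (A + B) = lim (exp (A / n) exp (B / n)) ^ n` gives the rates `‖Bᵢ‖` for
`u ↦ exp (A + ∑ uᵢ Bᵢ)`, with noncommuting coefficients (`boundedIncrements_exp_add_sum`). So the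
evolution `U(u)` has the rate `δt ‖H⁽μ⁾‖` in each coordinate `(μ, ν)`, and `⟨ψ|U† O U|ψ⟩` has
`C = ‖O‖` and twice these rates (`boundedIncrements_landscape`).

The constants become the stated ones by two shifts. Subtracting from `H⁽μ⁾` the midpoint of its
spectrum changes `U` by a phase only, so leaves the landscape unchanged, and makes the norm at most
`ωmax / 2`; subtracting a number from `O` changes the landscape by a constant, which
derivatives of order at least one do not see, and makes the norm at most `ΔO / 2`. Both norm bounds
come from the fact that the norm of a Hermitian operator is the supremum of its Rayleigh quotient
(`norm_sub_midpoint_le`).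
-/

open Filter Topology

/-! ### Functions with bounded iterated increments -/

section Increments

variable {ι E F : Type*} [DecidableEq ι]

/-- The increment `u ↦ f (u + s eᵢ) - f u` of `f` along the coordinate `i` with step `s`. -/
def increment [Sub E] (i : ι) (s : ℝ) (f : (ι → ℝ) → E) : (ι → ℝ) → E :=
  fun u => f (u + Pi.single i s) - f u

/-- The iterated increment of `f` for a list of pairs `(i, s)` of coordinates and steps. -/
def iteratedIncrement [Sub E] : List (ι × ℝ) → ((ι → ℝ) → E) → (ι → ℝ) → E
  | [], f => f
  | p :: l, f => iteratedIncrement l (increment p.1 p.2 f)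

/-- Every iterated increment of `f`, with coordinates `i₁, …, iₚ` and steps `s₁, …, sₚ`, is bounded
by `C ∏ₖ a iₖ |sₖ|`. For a smooth `f` this amounts to the bounds `C ∏ₖ a iₖ` of the mixed partial
derivatives, but it makes sense, and passes to pointwise limits, without differentiability. -/
def BoundedIncrements [Norm E] [Sub E] (f : (ι → ℝ) → E) (C : ℝ) (a : ι → ℝ) : Prop :=
  ∀ (l : List (ι × ℝ)) (u : ι → ℝ),
    ‖iteratedIncrement l f u‖ ≤ C * (l.map fun p => a p.1 * |p.2|).prod

theorem iteratedIncrement_add [AddCommGroup E] (l : List (ι × ℝ)) (f g : (ι → ℝ) → E) :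
    iteratedIncrement l (f + g) = iteratedIncrement l f + iteratedIncrement l g := by
  induction l generalizing f g with
  | nil => rfl
  | cons p l ih =>
    simp only [iteratedIncrement]
    rw [← ih]
    congr 1
    funext u
    simp only [increment, Pi.add_apply]
    abel

theorem iteratedIncrement_map [AddCommGroup E] [AddCommGroup F] (L : E →+ F) (l : List (ι × ℝ))
    (f : (ι → ℝ) → E) (u : ι → ℝ) :
    iteratedIncrement l (fun u => L (f u)) u = L (iteratedIncrement l f u) := by
  induction l generalizing f with
  | nil => rfl
  | cons p l ih =>
    simp only [iteratedIncrement]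
    rw [← ih]
    congr 1
    funext u
    simp [increment]

theorem iteratedIncrement_translate [AddCommGroup E] (l : List (ι × ℝ)) (f : (ι → ℝ) → E)
    (v u : ι → ℝ) :
    iteratedIncrement l (fun u => f (u + v)) u = iteratedIncrement l f (u + v) := by
  induction l generalizing f with
  | nil => rfl
  | cons p l ih =>
    simp only [iteratedIncrement]
    rw [← ih]
    congr 1
    funext u
    simp only [increment, add_right_comm]

theorem iteratedIncrement_zero [AddCommGroup E] (l : List (ι × ℝ)) :
    iteratedIncrement l (0 : (ι → ℝ) → E) = 0 := by
  have h := iteratedIncrement_add l (0 : (ι → ℝ) → E) 0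
  simpa using h

theorem tendsto_iteratedIncrement [NormedAddCommGroup E] {κ : Type*} {𝓕 : Filter κ}
    {f : κ → (ι → ℝ) → E} {g : (ι → ℝ) → E} (h : ∀ u, Tendsto (fun n => f n u) 𝓕 (𝓝 (g u)))
    (l : List (ι × ℝ)) (u : ι → ℝ) :
    Tendsto (fun n => iteratedIncrement l (f n) u) 𝓕 (𝓝 (iteratedIncrement l g u)) := by
  induction l generalizing f g with
  | nil => exact h u
  | cons p l ih => exact ih fun u => (h _).sub (h u)

namespace BoundedIncrements

variable {C D : ℝ} {a b : ι → ℝ}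

section Group

variable [NormedAddCommGroup E] [NormedAddCommGroup F] {f g : (ι → ℝ) → E}

theorem norm_le (hf : BoundedIncrements f C a) (u : ι → ℝ) : ‖f u‖ ≤ C := by
  simpa [iteratedIncrement] using hf [] u

theorem nonneg (hf : BoundedIncrements f C a) : 0 ≤ C :=
  (norm_nonneg _).trans (hf.norm_le 0)

theorem increment (hf : BoundedIncrements f C a) (i : ι) (s : ℝ) :
    BoundedIncrements (increment i s f) (C * (a i * |s|)) a := fun l u => by
  simpa [iteratedIncrement, mul_assoc] using hf ((i, s) :: l) u

theorem translate (hf : BoundedIncrements f C a) (v : ι → ℝ) :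
    BoundedIncrements (fun u => f (u + v)) C a := fun l u => by
  rw [iteratedIncrement_translate]
  exact hf l (u + v)

theorem map (hf : BoundedIncrements f C a) (L : E →+ F) {K : ℝ} (hK : 0 ≤ K)
    (hL : ∀ x, ‖L x‖ ≤ K * ‖x‖) : BoundedIncrements (fun u => L (f u)) (K * C) a := fun l u => by
  rw [iteratedIncrement_map, mul_assoc]
  exact (hL _).trans (mul_le_mul_of_nonneg_left (hf l u) hK)

theorem of_tendsto {κ : Type*} {𝓕 : Filter κ} [𝓕.NeBot] {f : κ → (ι → ℝ) → E}
    (hf : ∀ᶠ n in 𝓕, BoundedIncrements (f n) C a)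
    (h : ∀ u, Tendsto (fun n => f n u) 𝓕 (𝓝 (g u))) : BoundedIncrements g C a := fun l u =>
  le_of_tendsto (tendsto_iteratedIncrement h l u).norm (hf.mono fun _ hn => hn l u)

theorem mono (hf : BoundedIncrements f C a) (ha : ∀ i, 0 ≤ a i) (hab : ∀ i, a i ≤ b i)
    (hCD : C ≤ D) : BoundedIncrements f D b := fun l u => by
  refine (hf l u).trans (mul_le_mul hCD ?_ ?_ (hf.nonneg.trans hCD))
  · exact List.prod_map_le_prod_map₀ _ _ (fun p _ => mul_nonneg (ha _) (abs_nonneg _))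
      fun p _ => mul_le_mul_of_nonneg_right (hab _) (abs_nonneg _)
  · refine List.prod_nonneg fun x hx => ?_
    obtain ⟨p, -, rfl⟩ := List.mem_map.1 hx
    exact mul_nonneg (ha _) (abs_nonneg _)

theorem const (x : E) : BoundedIncrements (fun _ : ι → ℝ => x) ‖x‖ 0 := fun l u => by
  cases l with
  | nil => simp [iteratedIncrement]
  | cons p l =>
    have : _root_.increment p.1 p.2 (fun _ : ι → ℝ => x) = 0 := by
      funext u
      simp [_root_.increment]
    simp [iteratedIncrement, this, iteratedIncrement_zero]

end Group

section Ring

variable {R : Type*} [NormedRing R]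

/-- The discrete Leibniz rule `Δ(fg) = Δf · g(· + s eᵢ) + f · Δg`, iterated: the bounds `a` and `b`
of the factors add up. -/
theorem mul {f g : (ι → ℝ) → R} (hf : BoundedIncrements f C a) (hg : BoundedIncrements g D b) :
    BoundedIncrements (fun u => f u * g u) (C * D) (a + b) := fun l => by
  induction l generalizing f g C D with
  | nil =>
    intro u
    simpa [iteratedIncrement] using (norm_mul_le _ _).trans
      (mul_le_mul (hf.norm_le u) (hg.norm_le u) (norm_nonneg _) hf.nonneg)
  | cons p l ih =>
    intro u
    have key : _root_.increment p.1 p.2 (fun u => f u * g u) =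
        (fun u => _root_.increment p.1 p.2 f u * g (u + Pi.single p.1 p.2)) +
          fun u => f u * _root_.increment p.1 p.2 g u := by
      funext u
      simp only [_root_.increment, Pi.add_apply]
      noncomm_ring
    simp only [iteratedIncrement, List.map_cons, List.prod_cons, Pi.add_apply]
    rw [key, iteratedIncrement_add]
    refine (norm_add_le _ _).trans ((add_le_add
      (ih (hf.increment p.1 p.2) (hg.translate _) u) (ih hf (hg.increment p.1 p.2) u)).trans_eq ?_)
    simp only [Pi.add_apply]
    ring

variable [NormOneClass R]

theorem pow {f : (ι → ℝ) → R} (hf : BoundedIncrements f 1 a) (n : ℕ) :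
    BoundedIncrements (fun u => f u ^ n) 1 (n • a) := by
  induction n with
  | zero => simpa using const (ι := ι) (1 : R)
  | succ n ih => simpa only [pow_succ, succ_nsmul, one_mul] using ih.mul hf

theorem list_prod {κ : Type*} {f : κ → (ι → ℝ) → R} {a : κ → ι → ℝ}
    (hf : ∀ k, BoundedIncrements (f k) 1 (a k)) (l : List κ) :
    BoundedIncrements (fun u => (l.map fun k => f k u).prod) 1 (l.map a).sum := by
  induction l with
  | nil => simpa using const (ι := ι) (1 : R)
  | cons k l ih => simpa using (hf k).mul ih

end Ring

end BoundedIncrements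

end Increments

/-! ### Mixed partial derivatives -/

section Partial

variable {ι : Type} [DecidableEq ι] {f : (ι → ℝ) → ℝ}

/-- A partial derivative is the pointwise limit of the difference quotients `s⁻¹ Δf`. -/
theorem BoundedIncrements.partialDeriv [Fintype ι] {C : ℝ} {a : ι → ℝ}
    (hf : BoundedIncrements f C a) (hd : Differentiable ℝ f) (i : ι) :
    BoundedIncrements (partialDeriv i f) (C * a i) a := by
  refine of_tendsto (𝓕 := 𝓝[≠] (0 : ℝ)) (f := fun s u => s⁻¹ * _root_.increment i s f u) ?_ ?_
  · filter_upwards [self_mem_nhdsWithin] with s hs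
    convert! (hf.increment i s).map (AddMonoidHom.mulLeft s⁻¹) (abs_nonneg s⁻¹)
      (fun x => (norm_mul_le _ _)) using 1
    have : |s| ≠ 0 := abs_ne_zero.2 hs
    rw [abs_inv]
    field_simp
  · intro u
    have h := ((hd u).lineDifferentiableAt (v := Pi.single i 1)).hasLineDerivAt.tendsto_slope_zero
    simpa [_root_.increment, ← Pi.single_smul', smul_eq_mul] using! h

theorem contDiff_partialDeriv [Fintype ι] (hf : ContDiff ℝ (⊤ : ℕ∞) f) (i : ι) :
    ContDiff ℝ (⊤ : ℕ∞) (partialDeriv i f) := by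
  have h : partialDeriv i f = fun u => fderiv ℝ f u (Pi.single i 1) := by
    funext u
    exact (hf.differentiable (by simp) u).lineDeriv_eq_fderiv
  rw [h]
  exact (hf.fderiv_right (m := (⊤ : ℕ∞)) (by simp)).clm_apply contDiff_const

theorem contDiff_mixedPartial [Fintype ι] (hf : ContDiff ℝ (⊤ : ℕ∞) f) (is : List ι) :
    ContDiff ℝ (⊤ : ℕ∞) (mixedPartial is f) := by
  induction is with
  | nil => exact hf
  | cons i is ih => exact contDiff_partialDeriv ih i

theorem BoundedIncrements.mixedPartial [Fintype ι] {C : ℝ} {a : ι → ℝ}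
    (hf : BoundedIncrements f C a) (hd : ContDiff ℝ (⊤ : ℕ∞) f) (is : List ι) :
    BoundedIncrements (mixedPartial is f) (C * (is.map a).prod) a := by
  induction is with
  | nil => simpa [_root_.mixedPartial] using hf
  | cons i is ih =>
    have h := ih.partialDeriv ((contDiff_mixedPartial hd is).differentiable (by simp)) i
    rw [List.map_cons, List.prod_cons, mul_comm (a i), ← mul_assoc]
    exact h

theorem mixedPartial_add_const {is : List ι} (his : is ≠ []) (f : (ι → ℝ) → ℝ) (c : ℝ) :
    mixedPartial is (fun u => f u + c) = mixedPartial is f := by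
  induction is with
  | nil => exact absurd rfl his
  | cons i is ih =>
    rcases eq_or_ne is [] with rfl | h
    · funext u
      simp [mixedPartial, partialDeriv, lineDeriv]
    · exact congrArg (partialDeriv i) (ih h)

end Partial

/-! ### Exponentials of skew-adjoint elements -/

section SkewAdjoint

variable {R : Type*} [CStarAlgebra R]

theorem exp_mem_unitary_of_skewAdjoint {X : R} (hX : X ∈ skewAdjoint R) :
    NormedSpace.exp X ∈ unitary R :=
  let +nondep : NormedAlgebra ℚ R := .restrictScalars ℚ ℂ R
  NormedSpace.exp_mem_unitary_of_mem_skewAdjoint hX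

variable [Nontrivial R]

theorem norm_exp_of_skewAdjoint {X : R} (hX : X ∈ skewAdjoint R) : ‖NormedSpace.exp X‖ = 1 :=
  CStarRing.norm_of_mem_unitary (exp_mem_unitary_of_skewAdjoint hX)

theorem norm_exp_sub_one_le_of_skewAdjoint {X : R} (hX : X ∈ skewAdjoint R) (s : ℝ) :
    ‖NormedSpace.exp (s • X) - 1‖ ≤ ‖X‖ * |s| := by
  have h := convex_univ.norm_image_sub_le_of_norm_hasDerivWithin_le (x := (0 : ℝ)) (y := s)
    (f := fun s : ℝ => NormedSpace.exp (s • X)) (C := ‖X‖)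
    (fun t _ => (hasDerivAt_exp_smul_const (𝕂 := ℝ) X t).hasDerivWithinAt)
    (fun t _ => (norm_mul_le _ _).trans_eq <| by
      rw [norm_exp_of_skewAdjoint (skewAdjoint.smul_mem t hX), one_mul])
    (Set.mem_univ _) (Set.mem_univ _)
  simpa using h

theorem norm_pow_sub_pow_le {x y : R} (hx : ‖x‖ ≤ 1) (hy : ‖y‖ ≤ 1) (n : ℕ) :
    ‖x ^ n - y ^ n‖ ≤ n * ‖x - y‖ := by
  induction n with
  | zero => simp
  | succ n ih =>
    have key : x ^ (n + 1) - y ^ (n + 1) = (x ^ n - y ^ n) * x + y ^ n * (x - y) := by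
      rw [pow_succ, pow_succ]
      noncomm_ring
    have hyn : ‖y ^ n‖ ≤ 1 := (norm_pow_le y n).trans (pow_le_one₀ (norm_nonneg _) hy)
    rw [key]
    calc _ ≤ ‖x ^ n - y ^ n‖ * ‖x‖ + ‖y ^ n‖ * ‖x - y‖ :=
          norm_add_le_of_le (norm_mul_le _ _) (norm_mul_le _ _)
      _ ≤ ‖x ^ n - y ^ n‖ * 1 + 1 * ‖x - y‖ := by gcongr
      _ ≤ _ := by push_cast; linarith

/-- The Lie product formula, for skew-adjoint elements: as all the exponentials are unitary, it is
enough that `exp (s A) exp (s B)` and `exp (s (A + B))` agree to first order at `s = 0`. -/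
theorem tendsto_exp_mul_exp_pow {A B : R} (hA : A ∈ skewAdjoint R) (hB : B ∈ skewAdjoint R) :
    Tendsto (fun n : ℕ =>
      (NormedSpace.exp ((n : ℝ)⁻¹ • A) * NormedSpace.exp ((n : ℝ)⁻¹ • B)) ^ n) atTop
      (𝓝 (NormedSpace.exp (A + B))) := by
  let +nondep : NormedAlgebra ℚ R := .restrictScalars ℚ ℂ R
  let g : ℝ → R := fun s =>
    NormedSpace.exp (s • A) * NormedSpace.exp (s • B) - NormedSpace.exp (s • (A + B))
  have hg : HasDerivAt g 0 0 := by
    have h := ((hasDerivAt_exp_smul_const (𝕂 := ℝ) A 0).mul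
      (hasDerivAt_exp_smul_const (𝕂 := ℝ) B 0)).sub (hasDerivAt_exp_smul_const (𝕂 := ℝ) (A + B) 0)
    refine HasDerivAt.congr_deriv (f := g) h ?_
    simp [NormedSpace.exp_zero]
  have hlim : Tendsto (fun n : ℕ => (n : ℝ) * ‖g ((n : ℝ)⁻¹)‖) atTop (𝓝 0) := by
    have h0 : Tendsto (fun n : ℕ => (n : ℝ)⁻¹) atTop (𝓝[≠] 0) :=
      tendsto_nhdsWithin_iff.2 ⟨tendsto_inv_atTop_nhds_zero_nat, by
        filter_upwards [eventually_ne_atTop 0] with n hn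
        simpa using hn⟩
    have h := (hg.tendsto_slope_zero.comp h0).norm
    simpa [g, NormedSpace.exp_zero, norm_smul, Function.comp_def] using h
  refine tendsto_iff_norm_sub_tendsto_zero.2 (squeeze_zero' (.of_forall fun _ => norm_nonneg _) ?_
    hlim)
  filter_upwards [eventually_ne_atTop 0] with n hn
  have hexp : NormedSpace.exp (A + B) = NormedSpace.exp ((n : ℝ)⁻¹ • (A + B)) ^ n := by
    rw [← NormedSpace.exp_nsmul, ← Nat.cast_smul_eq_nsmul ℝ n, smul_smul,
      mul_inv_cancel₀ (Nat.cast_ne_zero.2 hn), one_smul]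
  rw [hexp]
  refine norm_pow_sub_pow_le ((norm_mul_le _ _).trans_eq ?_) (le_of_eq ?_) n
  · rw [norm_exp_of_skewAdjoint (skewAdjoint.smul_mem _ hA),
      norm_exp_of_skewAdjoint (skewAdjoint.smul_mem _ hB), one_mul]
  · exact norm_exp_of_skewAdjoint (skewAdjoint.smul_mem _ (add_mem hA hB))

variable {ι : Type*} [DecidableEq ι]

/-- Every increment along the coordinate `i` multiplies `exp (uᵢ X)` by a constant
`exp (s X) - 1`, of norm at most `|s| ‖X‖`. -/
theorem boundedIncrements_exp_coord_smul {X : R} (hX : X ∈ skewAdjoint R) (i : ι) :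
    BoundedIncrements (fun u : ι → ℝ => NormedSpace.exp (u i • X)) 1 (Pi.single i ‖X‖) := by
  let +nondep : NormedAlgebra ℚ R := .restrictScalars ℚ ℂ R
  have key : ∀ (l : List (ι × ℝ)) (Y : R) (u : ι → ℝ),
      ‖iteratedIncrement l (fun u : ι → ℝ => Y * NormedSpace.exp (u i • X)) u‖ ≤
        ‖Y‖ * (l.map fun p => (Pi.single i ‖X‖ : ι → ℝ) p.1 * |p.2|).prod := by
    intro l
    induction l with
    | nil =>
      intro Y u
      refine (norm_mul_le _ _).trans_eq ?_
      rw [norm_exp_of_skewAdjoint (skewAdjoint.smul_mem _ hX)]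
      simp
    | cons p l ih =>
      obtain ⟨j, s⟩ := p
      intro Y u
      have h : increment j s (fun u : ι → ℝ => Y * NormedSpace.exp (u i • X)) =
          fun u => (Y * (NormedSpace.exp ((Pi.single j s : ι → ℝ) i • X) - 1)) *
            NormedSpace.exp (u i • X) := by
        funext u
        have hc : Commute ((Pi.single j s : ι → ℝ) i • X) (u i • X) :=
          ((Commute.refl X).smul_left _).smul_right _
        rw [increment, Pi.add_apply, add_comm, add_smul, NormedSpace.exp_add_of_commute hc]
        noncomm_ring
      simp only [iteratedIncrement, List.map_cons, List.prod_cons, ← mul_assoc]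
      rw [h]
      refine (ih _ u).trans (mul_le_mul_of_nonneg_right ?_ ?_)
      · rw [mul_assoc]
        refine (norm_mul_le _ _).trans (mul_le_mul_of_nonneg_left ?_ (norm_nonneg _))
        rcases eq_or_ne j i with rfl | hji
        · simpa using norm_exp_sub_one_le_of_skewAdjoint hX s
        · simp [Pi.single_eq_of_ne hji, Pi.single_eq_of_ne hji.symm, NormedSpace.exp_zero]
      · refine List.prod_nonneg fun x hx => ?_
        obtain ⟨p, -, rfl⟩ := List.mem_map.1 hx
        have : (0 : ι → ℝ) ≤ Pi.single i ‖X‖ := Pi.single_nonneg.2 (norm_nonneg X)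
        exact mul_nonneg (this _) (abs_nonneg _)
  intro l u
  simpa using key l 1 u

/-- By the Lie product formula, `exp (A + ∑ uᵢ Bᵢ + uⱼ Bⱼ)` is the limit of the `n`-th powers of
`exp ((A + ∑ uᵢ Bᵢ) / n) exp (uⱼ Bⱼ / n)`. The bounds for the factors are `1 / n` of those for
`A + ∑ uᵢ Bᵢ` and for `uⱼ Bⱼ`, so that those of the power do not depend on `n`. -/
theorem boundedIncrements_exp_add_sum (s : Finset ι) {A : R} {B : ι → R}
    (hA : A ∈ skewAdjoint R) (hB : ∀ i, B i ∈ skewAdjoint R) :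
    BoundedIncrements (fun u : ι → ℝ => NormedSpace.exp (A + ∑ i ∈ s, u i • B i)) 1
      (∑ i ∈ s, Pi.single i ‖B i‖) := by
  induction s using Finset.induction_on generalizing A B with
  | empty => simpa [norm_exp_of_skewAdjoint hA] using
      BoundedIncrements.const (ι := ι) (NormedSpace.exp A)
  | insert j s hj ih =>
    refine BoundedIncrements.of_tendsto (𝓕 := atTop)
      (f := fun (n : ℕ) u => (NormedSpace.exp ((n : ℝ)⁻¹ • (A + ∑ i ∈ s, u i • B i)) *
        NormedSpace.exp ((n : ℝ)⁻¹ • (u j • B j))) ^ n) ?_ ?_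
    · filter_upwards [eventually_ne_atTop 0] with n hn
      have h := ((ih (skewAdjoint.smul_mem (n : ℝ)⁻¹ hA)
        fun i => skewAdjoint.smul_mem (n : ℝ)⁻¹ (hB i)).mul (boundedIncrements_exp_coord_smul
          (skewAdjoint.smul_mem (n : ℝ)⁻¹ (hB j)) j))
      rw [one_mul] at h
      convert! h.pow n using 1
      · funext u
        simp only [smul_add, Finset.smul_sum, smul_comm (n : ℝ)⁻¹]
      · have hsingle : ∀ i, (Pi.single i ‖B i‖ : ι → ℝ) = n • Pi.single i ‖(n : ℝ)⁻¹ • B i‖ := by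
          intro i
          have hn' : (n : ℝ) ≠ 0 := Nat.cast_ne_zero.2 hn
          rw [← Pi.single_smul', norm_smul, nsmul_eq_mul, norm_inv, Real.norm_natCast,
            mul_inv_cancel_left₀ hn']
        rw [Finset.sum_insert hj, add_comm, smul_add, Finset.smul_sum, ← hsingle]
        exact congrArg (· + _) (Finset.sum_congr rfl fun i _ => hsingle i)
    · intro u
      have h := tendsto_exp_mul_exp_pow (A := A + ∑ i ∈ s, u i • B i) (B := u j • B j)
        (add_mem hA (sum_mem fun i _ => skewAdjoint.smul_mem _ (hB i)))
        (skewAdjoint.smul_mem _ (hB j))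
      rwa [Finset.sum_insert hj, add_comm (u j • B j), ← add_assoc]

end SkewAdjoint

/-! ### Self-adjoint elements -/

section SelfAdjoint

variable {R : Type*} [CStarAlgebra R]

theorem isSelfAdjoint_ofReal_smul {A : R} (hA : IsSelfAdjoint A) (c : ℝ) :
    IsSelfAdjoint ((c : ℂ) • A) :=
  IsSelfAdjoint.smul (Complex.conj_ofReal c) hA

theorem isSelfAdjoint_sub_ofReal_smul_one {A : R} (hA : IsSelfAdjoint A) (c : ℝ) :
    IsSelfAdjoint (A - (c : ℂ) • 1) :=
  hA.sub (isSelfAdjoint_ofReal_smul (.one R) c)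

theorem isSelfAdjoint_add_sum_ofReal_smul {κ : Type*} [Fintype κ] {A : R} (hA : IsSelfAdjoint A)
    {B : κ → R} (hB : ∀ k, IsSelfAdjoint (B k)) (u : κ → ℝ) :
    IsSelfAdjoint (A + ∑ k, (u k : ℂ) • B k) :=
  hA.add (isSelfAdjoint_sum _ fun k _ => isSelfAdjoint_ofReal_smul (hB k) (u k))

/-- An affine function of the coordinates `(k, k')` with `k'` fixed is one of all coordinates, in
which the others have the coefficient `0`. -/
theorem smul_add_sum_eq_sum_prod {κ κ' : Type*} [Fintype κ] [Fintype κ'] [DecidableEq κ'] (z : ℂ)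
    (A : R) (B : κ → R) (u : κ × κ' → ℝ) (k' : κ') :
    z • (A + ∑ k, (u (k, k') : ℂ) • B k) =
      z • A + ∑ i, u i • if i.2 = k' then z • B i.1 else 0 := by
  rw [smul_add, Finset.smul_sum, Fintype.sum_prod_type]
  congr 1
  refine Finset.sum_congr rfl fun k _ => ?_
  rw [Finset.sum_eq_single k' (fun j _ h => by rw [if_neg h, smul_zero]) (by simp), if_pos rfl,
    smul_comm, Complex.coe_smul]

end SelfAdjoint

/-! ### Expectation values and spectra of Hermitian operators -/

section Spectral

variable {D : ℕ}

theorem expectation_eq_reApplyInnerSelf (A : QOp D) (φ : QState D) :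
    expectation A φ = A.reApplyInnerSelf φ := by
  exact inner_re_symm (𝕜 := ℂ) φ (A φ)

theorem abs_expectation_le (A : QOp D) {φ : QState D} (hφ : ‖φ‖ = 1) :
    |expectation A φ| ≤ ‖A‖ := by
  have h := A.rayleighQuotient_le_norm φ
  rwa [ContinuousLinearMap.rayleighQuotient, ← expectation_eq_reApplyInnerSelf, hφ, one_pow,
    div_one] at h

/-- The norm of a Hermitian operator is the largest modulus of its expectation values, so that
shifting the operator by the midpoint of an interval that contains them makes the norm at most half
the length of that interval. -/
theorem norm_sub_midpoint_le [NeZero D] {A : QOp D} (hA : IsSelfAdjoint A) {l r : ℝ}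
    (h : ∀ φ : QState D, ‖φ‖ = 1 → l ≤ expectation A φ ∧ expectation A φ ≤ r) :
    ‖A - (((l + r) / 2 : ℝ) : ℂ) • 1‖ ≤ (r - l) / 2 := by
  set B : QOp D := A - (((l + r) / 2 : ℝ) : ℂ) • 1 with hBdef
  have hB : IsSelfAdjoint B := isSelfAdjoint_sub_ofReal_smul_one hA _
  have hexp : ∀ φ : QState D, ‖φ‖ = 1 → expectation B φ = expectation A φ - (l + r) / 2 := by
    intro φ hφ
    have h1 : inner ℂ φ φ = (1 : ℂ) := by simp [inner_self_eq_norm_sq_to_K, hφ]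
    simp only [expectation, hBdef, _root_.sub_apply, inner_sub_right,
      _root_.smul_apply, one_apply_eq_self, inner_smul_right, h1,
      Complex.sub_re, mul_one, Complex.ofReal_re]
  obtain ⟨φ₀, hφ₀⟩ := exists_norm_eq (QState D) zero_le_one
  have hlr : 0 ≤ (r - l) / 2 := by linarith [(h φ₀ hφ₀).1, (h φ₀ hφ₀).2]
  rw [B.norm_eq_iSup_rayleighQuotient (ContinuousLinearMap.isSelfAdjoint_iff_isSymmetric.1 hB)]
  refine ciSup_le fun x => ?_
  rcases eq_or_ne x 0 with rfl | hx
  · simpa using hlr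
  · have hx1 : ‖((‖x‖⁻¹ : ℝ) : ℂ) • x‖ = 1 := by
      rw [norm_smul, Complex.norm_real, norm_inv, norm_norm,
        inv_mul_cancel₀ (norm_ne_zero_iff.2 hx)]
    have hc : ((‖x‖⁻¹ : ℝ) : ℂ) ≠ 0 := by simpa using hx
    have hr := B.rayleigh_smul x hc
    rw [← hr, ContinuousLinearMap.rayleighQuotient, ← expectation_eq_reApplyInnerSelf, hx1, one_pow,
      div_one, hexp _ hx1, abs_le]
    constructor <;> linarith [(h _ hx1).1, (h _ hx1).2]

theorem finite_realEigenvalues (A : QOp D) : (realEigenvalues A).Finite :=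
  (Module.End.finite_hasEigenvalue (A : QState D →ₗ[ℂ] QState D)).preimage
    Complex.ofReal_injective.injOn

/-- The extreme values of the Rayleigh quotient are eigenvalues. -/
theorem expectation_mem_Icc_realEigenvalues [NeZero D] {A : QOp D} (hA : IsSelfAdjoint A)
    {φ : QState D} (hφ : ‖φ‖ = 1) :
    sInf (realEigenvalues A) ≤ expectation A φ ∧ expectation A φ ≤ sSup (realEigenvalues A) := by
  have hsymm := ContinuousLinearMap.isSelfAdjoint_iff_isSymmetric.1 hA
  have hφ0 : φ ≠ 0 := norm_ne_zero_iff.1 (by simp [hφ])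
  let q : { x : QState D // x ≠ 0 } → ℝ := fun x =>
    RCLike.re (inner ℂ ((A : QState D →ₗ[ℂ] QState D) x) x) / ‖(x : QState D)‖ ^ 2
  have hq : expectation A φ = q ⟨φ, hφ0⟩ := by
    simp [q, expectation_eq_reApplyInnerSelf, ContinuousLinearMap.reApplyInnerSelf_apply, hφ]
  have hbd : ∀ x, |q x| ≤ ‖A‖ := fun x => A.rayleighQuotient_le_norm x
  rw [hq]
  constructor
  · exact (csInf_le (finite_realEigenvalues A).bddBelow
      hsymm.hasEigenvalue_iInf_of_finiteDimensional).trans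
      (ciInf_le (f := q) ⟨-‖A‖, by rintro _ ⟨x, rfl⟩; exact (abs_le.1 (hbd x)).1⟩ _)
  · exact (le_ciSup (f := q) ⟨‖A‖, by rintro _ ⟨x, rfl⟩; exact (abs_le.1 (hbd x)).2⟩ _).trans
      (le_csSup (finite_realEigenvalues A).bddAbove
        hsymm.hasEigenvalue_iSup_of_finiteDimensional)

theorem exists_norm_sub_smul_one_le_spectralWidth [NeZero D] {A : QOp D} (hA : IsSelfAdjoint A) :
    ∃ c : ℝ, ‖A - (c : ℂ) • 1‖ ≤ spectralWidth A / 2 :=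
  ⟨_, norm_sub_midpoint_le hA fun _ hφ => expectation_mem_Icc_realEigenvalues hA hφ⟩

theorem exists_norm_sub_smul_one_le_expectationRange [NeZero D] {A : QOp D} (hA : IsSelfAdjoint A) :
    ∃ c : ℝ, ‖A - (c : ℂ) • 1‖ ≤ expectationRange A / 2 := by
  refine ⟨_, norm_sub_midpoint_le hA fun φ hφ => ⟨csInf_le ⟨-‖A‖, ?_⟩ ⟨φ, hφ, rfl⟩,
    le_csSup ⟨‖A‖, ?_⟩ ⟨φ, hφ, rfl⟩⟩⟩
  · rintro _ ⟨φ, hφ, rfl⟩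
    exact (abs_le.1 (abs_expectation_le A hφ)).1
  · rintro _ ⟨φ, hφ, rfl⟩
    exact (abs_le.1 (abs_expectation_le A hφ)).2

theorem expectation_rankOne (χ φ : QState D) :
    expectation (InnerProductSpace.rankOne ℂ χ χ) φ = ‖inner ℂ χ φ‖ ^ 2 := by
  rw [expectation, InnerProductSpace.rankOne_apply, inner_smul_right, ← inner_conj_symm φ χ,
    Complex.mul_conj, Complex.ofReal_re, Complex.normSq_eq_norm_sq]

theorem expectation_rankOne_mem_Icc {χ φ : QState D} (hχ : ‖χ‖ = 1) (hφ : ‖φ‖ = 1) :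
    expectation (InnerProductSpace.rankOne ℂ χ χ) φ ∈ Set.Icc (0 : ℝ) 1 := by
  rw [expectation_rankOne]
  refine ⟨sq_nonneg _, pow_le_one₀ (norm_nonneg _) ?_⟩
  simpa [hχ, hφ] using norm_inner_le_norm (𝕜 := ℂ) χ φ

theorem expectationRange_rankOne_le {χ : QState D} (hχ : ‖χ‖ = 1) :
    expectationRange (InnerProductSpace.rankOne ℂ χ χ) ≤ 1 := by
  have hne : (expectationValues (InnerProductSpace.rankOne ℂ χ χ)).Nonempty := ⟨_, χ, hχ, rfl⟩
  have h1 := csSup_le (a := 1) hne (by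
    rintro _ ⟨φ, hφ, rfl⟩; exact (expectation_rankOne_mem_Icc hχ hφ).2)
  have h0 := le_csInf (a := 0) hne (by
    rintro _ ⟨φ, hφ, rfl⟩; exact (expectation_rankOne_mem_Icc hχ hφ).1)
  rw [expectationRange]
  linarith

/-- The maximum `1` is attained at `χ`, the minimum `0` at a unit vector orthogonal to `χ`. -/
theorem expectationRange_rankOne (hD : 2 ≤ D) {χ : QState D} (hχ : ‖χ‖ = 1) :
    expectationRange (InnerProductSpace.rankOne ℂ χ χ) = 1 := by
  have hrank : 0 < Module.finrank ℂ (ℂ ∙ χ)ᗮ := by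
    have h := (ℂ ∙ χ).finrank_add_finrank_orthogonal
    have h1 : Module.finrank ℂ (ℂ ∙ χ) ≤ 1 := (finrank_span_le_card {χ}).trans_eq (by simp)
    rw [finrank_euclideanSpace_fin] at h
    omega
  have : Nontrivial (ℂ ∙ χ)ᗮ := Module.nontrivial_of_finrank_pos hrank
  obtain ⟨η, hη⟩ := exists_norm_eq (ℂ ∙ χ)ᗮ zero_le_one
  have hmax : IsGreatest (expectationValues (InnerProductSpace.rankOne ℂ χ χ)) 1 :=
    ⟨⟨χ, hχ, by simp [expectation_rankOne, inner_self_eq_norm_sq_to_K, hχ]⟩, by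
      rintro _ ⟨φ, hφ, rfl⟩; exact (expectation_rankOne_mem_Icc hχ hφ).2⟩
  have hmin : IsLeast (expectationValues (InnerProductSpace.rankOne ℂ χ χ)) 0 :=
    ⟨⟨η, hη, by
      rw [expectation_rankOne, Submodule.mem_orthogonal_singleton_iff_inner_right.1 η.2]; simp⟩, by
      rintro _ ⟨φ, hφ, rfl⟩; exact (expectation_rankOne_mem_Icc hχ hφ).1⟩
  rw [expectationRange, hmax.csSup_eq, hmin.csInf_eq, sub_zero]

end Spectral

/-! ### The evolution and the landscape -/

section Landscape

variable {D M N : ℕ}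

theorem exp_add_smul_one {R : Type*} [CStarAlgebra R] (X : R) (z : ℂ) :
    NormedSpace.exp (X + z • 1) = Complex.exp z • NormedSpace.exp X := by
  let +nondep : NormedAlgebra ℚ R := .restrictScalars ℚ ℂ R
  rw [NormedSpace.exp_add_of_commute ((Commute.one_right X).smul_right z),
    ← Algebra.algebraMap_eq_smul_one, ← NormedSpace.algebraMap_exp_comm, Complex.exp_eq_exp_ℂ,
    Algebra.algebraMap_eq_smul_one, mul_smul_one]

/-- Shifting the control Hamiltonians by real numbers multiplies the propagator of a time step by a
phase. -/
theorem stepUnitary_eq_phase_smul (H₀ : QOp D) (H : Fin M → QOp D) (c : Fin M → ℝ) (δt : ℝ)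
    (u : Fin M → ℝ) : ∃ z : ℂ, ‖z‖ = 1 ∧
      stepUnitary H₀ H δt u = z • stepUnitary H₀ (fun μ => H μ - (c μ : ℂ) • 1) δt u := by
  refine ⟨Complex.exp ((-(δt * ∑ μ, u μ * c μ) : ℝ) * Complex.I),
    Complex.norm_exp_ofReal_mul_I _, ?_⟩
  rw [stepUnitary, stepUnitary, ← exp_add_smul_one]
  congr 1
  simp only [hamiltonian, smul_sub, Finset.sum_sub_distrib, smul_smul, ← Finset.sum_smul]
  rw [← add_sub_assoc, smul_sub, smul_smul]
  have : (-(Complex.I * (δt : ℂ))) * ∑ μ, (u μ : ℂ) * (c μ : ℂ) =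
      ((-(δt * ∑ μ, u μ * c μ) : ℝ) : ℂ) * Complex.I := by
    push_cast
    ring
  rw [this, sub_add_cancel]

theorem exists_list_prod_eq_phase_smul {R κ : Type*} [CStarAlgebra R] {f g : κ → R}
    (h : ∀ k, ∃ z : ℂ, ‖z‖ = 1 ∧ f k = z • g k) (l : List κ) :
    ∃ z : ℂ, ‖z‖ = 1 ∧ (l.map f).prod = z • (l.map g).prod := by
  induction l with
  | nil => exact ⟨1, by simp⟩
  | cons k l ih =>
    obtain ⟨z, hz, hfg⟩ := h k
    obtain ⟨w, hw, hl⟩ := ih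
    refine ⟨z * w, by simp [hz, hw], ?_⟩
    rw [List.map_cons, List.map_cons, List.prod_cons, List.prod_cons, hfg, hl, smul_mul_smul_comm]

theorem evolution_eq_list_prod (H₀ : QOp D) (H : Fin M → QOp D) (T : ℝ) (u : Fin M × Fin N → ℝ) :
    evolution H₀ H T u = ((List.finRange N).reverse.map fun ν =>
      stepUnitary H₀ H (timeStep T N) (fun μ => u (μ, ν))).prod := by
  rw [evolution, List.ofFn_eq_map, List.map_reverse]

/-- The phases that come from shifting the control Hamiltonians cancel in the landscape. -/
theorem landscape_sub_smul_one (H₀ : QOp D) (H : Fin M → QOp D) (c : Fin M → ℝ) (T : ℝ) (O : QOp D)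
    (ψ : QState D) : landscape (N := N) H₀ H T O ψ =
      landscape H₀ (fun μ => H μ - (c μ : ℂ) • 1) T O ψ := by
  funext u
  obtain ⟨z, hz, h⟩ := exists_list_prod_eq_phase_smul (fun ν => stepUnitary_eq_phase_smul H₀ H c
    (timeStep T N) (fun μ => u (μ, ν))) (List.finRange N).reverse
  have hz' : star z * z = 1 := by
    rw [Complex.star_def, Complex.conj_mul', hz]
    simp
  rw [← evolution_eq_list_prod, ← evolution_eq_list_prod] at h
  rw [landscape, landscape, ← ContinuousLinearMap.star_eq_adjoint,
    ← ContinuousLinearMap.star_eq_adjoint, h, star_smul, smul_mul_assoc, smul_mul_smul_comm, hz',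
    one_smul]

/-- The exponent of the time step `ν` as an affine function of all the control values
`u (μ, ν')`, in which those with `ν' ≠ ν` have the coefficient `0`. -/
theorem stepUnitary_eq_exp_sum (H₀ : QOp D) (H : Fin M → QOp D) (δt : ℝ) (u : Fin M × Fin N → ℝ)
    (ν : Fin N) : stepUnitary H₀ H δt (fun μ => u (μ, ν)) =
      NormedSpace.exp ((-(Complex.I * (δt : ℂ))) • H₀ + ∑ i : Fin M × Fin N,
        u i • if i.2 = ν then (-(Complex.I * (δt : ℂ))) • H i.1 else 0) := by
  exact congrArg NormedSpace.exp (smul_add_sum_eq_sum_prod _ H₀ H u ν)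

theorem neg_I_mul_smul_mem_skewAdjoint {A : QOp D} (hA : IsSelfAdjoint A) (δt : ℝ) :
    (-(Complex.I * (δt : ℂ))) • A ∈ skewAdjoint (QOp D) :=
  hA.smul_mem_skewAdjoint (by simp [skewAdjoint.mem_iff])

theorem evolution_mem_unitary {H₀ : QOp D} (hH₀ : IsSelfAdjoint H₀) {H : Fin M → QOp D}
    (hH : ∀ μ, IsSelfAdjoint (H μ)) (T : ℝ) (u : Fin M × Fin N → ℝ) :
    evolution H₀ H T u ∈ unitary (QOp D) := by
  rw [evolution_eq_list_prod]
  refine Submonoid.list_prod_mem _ fun x hx => ?_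
  obtain ⟨ν, -, rfl⟩ := List.mem_map.1 hx
  exact exp_mem_unitary_of_skewAdjoint (neg_I_mul_smul_mem_skewAdjoint
    (isSelfAdjoint_add_sum_ofReal_smul hH₀ hH _) _)

/-- Shifting the observable by a number shifts the landscape by a constant. -/
theorem landscape_eq_landscape_sub_add {H₀ : QOp D} (hH₀ : IsSelfAdjoint H₀)
    {H : Fin M → QOp D} (hH : ∀ μ, IsSelfAdjoint (H μ)) (T : ℝ) (O : QOp D) {ψ : QState D}
    (hψ : ‖ψ‖ = 1) (c : ℝ) : landscape (N := N) H₀ H T O ψ =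
      fun u => landscape H₀ H T (O - (c : ℂ) • 1) ψ u + c := by
  funext u
  have hU := (Unitary.mem_iff.1 (evolution_mem_unitary hH₀ hH T u)).1
  have h1 : inner ℂ ψ ψ = (1 : ℂ) := by simp [inner_self_eq_norm_sq_to_K, hψ]
  rw [landscape, landscape, ← ContinuousLinearMap.star_eq_adjoint, mul_sub, sub_mul,
    mul_smul_one, smul_mul_assoc, hU, expectation, expectation]
  simp only [_root_.sub_apply, inner_sub_right, _root_.smul_apply,
    one_apply_eq_self, inner_smul_right, h1, Complex.sub_re, mul_one, Complex.ofReal_re,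
    sub_add_cancel]

/-- `A ↦ ⟨ψ|A|ψ⟩` as an additive map. -/
noncomputable def expectationAddHom (ψ : QState D) : QOp D →+ ℝ where
  toFun A := expectation A ψ
  map_zero' := by simp [expectation]
  map_add' A B := by simp [expectation]

theorem boundedIncrements_evolution [NeZero D] {H₀ : QOp D} (hH₀ : IsSelfAdjoint H₀)
    {H : Fin M → QOp D} (hH : ∀ μ, IsSelfAdjoint (H μ)) (T : ℝ) :
    BoundedIncrements (evolution (N := N) H₀ H T) 1 (fun i => |timeStep T N| * ‖H i.1‖) := by
  have hstep : ∀ ν : Fin N, BoundedIncrements (fun u : Fin M × Fin N → ℝ =>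
      stepUnitary H₀ H (timeStep T N) (fun μ => u (μ, ν))) 1
      (fun i => if i.2 = ν then |timeStep T N| * ‖H i.1‖ else 0) := by
    intro ν
    simp only [stepUnitary_eq_exp_sum]
    convert! boundedIncrements_exp_add_sum Finset.univ
      (neg_I_mul_smul_mem_skewAdjoint hH₀ (timeStep T N))
      (B := fun i : Fin M × Fin N =>
        if i.2 = ν then (-(Complex.I * (timeStep T N : ℂ))) • H i.1 else 0) ?_ using 1
    · funext i
      rw [Finset.sum_apply, Finset.sum_pi_single]
      split_ifs <;> simp_all [norm_smul]
    · intro i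
      split_ifs
      · exact neg_I_mul_smul_mem_skewAdjoint (hH _) _
      · exact zero_mem _
  have h := BoundedIncrements.list_prod hstep (List.finRange N).reverse
  convert! h using 1
  · funext u
    exact evolution_eq_list_prod H₀ H T u
  · funext i
    rw [List.map_reverse, List.sum_reverse, ← List.ofFn_eq_map, List.sum_ofFn, Finset.sum_apply]
    simp

/-- The factors `U†` and `U` contribute the rates of `U` once each, the constant `O` contributes
none. -/
theorem boundedIncrements_landscape [NeZero D] {H₀ : QOp D} (hH₀ : IsSelfAdjoint H₀)
    {H : Fin M → QOp D} (hH : ∀ μ, IsSelfAdjoint (H μ)) (T : ℝ) (O : QOp D) {ψ : QState D}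
    (hψ : ‖ψ‖ = 1) :
    BoundedIncrements (landscape (N := N) H₀ H T O ψ) ‖O‖
      (fun i => 2 * (|timeStep T N| * ‖H i.1‖)) := by
  have hU := boundedIncrements_evolution (N := N) hH₀ hH T
  have hUstar := hU.map (starAddEquiv : QOp D ≃+ QOp D).toAddMonoidHom zero_le_one
    (fun x => by simp)
  have h := ((hUstar.mul (.const O)).mul hU).map (expectationAddHom ψ) zero_le_one
    (fun A => by simpa using! abs_expectation_le A hψ)
  convert! h using 1
  · ring
  · funext i
    simp only [Pi.add_apply, Pi.zero_apply]
    ring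

theorem contDiff_exp_real {R : Type*} [CStarAlgebra R] :
    ContDiff ℝ (⊤ : ℕ∞) (NormedSpace.exp : R → R) := by
  have h : ContDiff ℝ ⊤ (NormedSpace.exp : R → R) :=
    AnalyticOnNhd.contDiff fun x _ => NormedSpace.exp_analytic x
  exact h.of_le le_top

theorem contDiff_evolution (H₀ : QOp D) (H : Fin M → QOp D) (T : ℝ) :
    ContDiff ℝ (⊤ : ℕ∞) (evolution (N := N) H₀ H T) := by
  have hstep : ∀ ν : Fin N, ContDiff ℝ (⊤ : ℕ∞) (fun u : Fin M × Fin N → ℝ =>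
      stepUnitary H₀ H (timeStep T N) (fun μ => u (μ, ν))) := by
    intro ν
    simp only [stepUnitary_eq_exp_sum]
    exact contDiff_exp_real.comp (by fun_prop)
  have hprod : ∀ l : List (Fin N), ContDiff ℝ (⊤ : ℕ∞) (fun u : Fin M × Fin N → ℝ =>
      (l.map fun ν => stepUnitary H₀ H (timeStep T N) (fun μ => u (μ, ν))).prod) := by
    intro l
    induction l with
    | nil => simpa using contDiff_const
    | cons ν l ih => simpa using (hstep ν).mul ih
  have h : evolution (N := N) H₀ H T = fun u => ((List.finRange N).reverse.map fun ν =>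
      stepUnitary H₀ H (timeStep T N) (fun μ => u (μ, ν))).prod :=
    funext (evolution_eq_list_prod H₀ H T)
  rw [h]
  exact hprod _

theorem contDiff_landscape (H₀ : QOp D) (H : Fin M → QOp D) (T : ℝ) (O : QOp D) (ψ : QState D) :
    ContDiff ℝ (⊤ : ℕ∞) (landscape (N := N) H₀ H T O ψ) := by
  have hU := contDiff_evolution (N := N) H₀ H T
  have hUstar := (starL' ℝ : QOp D ≃L[ℝ] QOp D).contDiff.comp hU
  have h := (hUstar.mul (contDiff_const (c := O))).mul hU
  have hψ := ((ContinuousLinearMap.apply ℂ (QState D) ψ).restrictScalars ℝ).contDiff.comp h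
  exact Complex.reCLM.contDiff.comp ((contDiff_const (c := ψ)).inner ℂ hψ)

/-- The increments are estimated for the Hamiltonians and the observable shifted by the midpoints of
their spectral and expectation ranges. -/
theorem abs_mixedPartial_landscape_le [NeZero D] {H₀ : QOp D} (hH₀ : IsSelfAdjoint H₀)
    {H : Fin M → QOp D} (hH : ∀ μ, IsSelfAdjoint (H μ)) {T : ℝ} (hT : 0 ≤ T) {ω : ℝ}
    (hω : ∀ μ, spectralWidth (H μ) = ω) {O : QOp D} (hO : IsSelfAdjoint O) {ψ : QState D}
    (hψ : ‖ψ‖ = 1) {P : ℕ} (hP : 1 ≤ P) (i : Fin P → Fin M × Fin N) (u : Fin M × Fin N → ℝ) :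
    |mixedPartial (List.ofFn i) (landscape H₀ H T O ψ) u| ≤
      (ω * timeStep T N) ^ P * (expectationRange O / 2) := by
  choose c hc using fun μ => exists_norm_sub_smul_one_le_spectralWidth (hH μ)
  obtain ⟨d, hd⟩ := exists_norm_sub_smul_one_le_expectationRange hO
  have hH' : ∀ μ, IsSelfAdjoint (H μ - (c μ : ℂ) • 1) := fun μ =>
    isSelfAdjoint_sub_ofReal_smul_one (hH μ) _
  have hne : List.ofFn i ≠ [] := by
    rw [Ne, List.ofFn_eq_nil_iff]
    omega
  rw [landscape_sub_smul_one H₀ H c, landscape_eq_landscape_sub_add hH₀ hH' T O hψ d,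
    mixedPartial_add_const hne]
  have hδt : 0 ≤ timeStep T N := div_nonneg hT (Nat.cast_nonneg N)
  have hJ := (boundedIncrements_landscape (N := N) hH₀ hH' T (O - (d : ℂ) • 1) hψ).mono
    (b := fun _ => ω * timeStep T N) (fun _ => by positivity) (fun i => by
      have h := hc i.1
      rw [hω] at h
      rw [abs_of_nonneg hδt]
      nlinarith) hd
  have h := (hJ.mixedPartial (contDiff_landscape _ _ _ _ _) (List.ofFn i)).norm_le u
  rwa [List.map_const', List.length_ofFn, List.prod_replicate, mul_comm] at h

end Landscape

theorem lemma4 (D M N : ℕ) (hN : 1 ≤ N) (T : ℝ) (hT : 0 ≤ T)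
    (H₀ : QOp D) (hH₀ : IsSelfAdjoint H₀)
    (H : Fin M → QOp D) (hH : ∀ μ, IsSelfAdjoint (H μ))
    (ωmax : ℝ) (hω : ∀ μ, spectralWidth (H μ) = ωmax)
    (ψ : QState D) (hψ : ‖ψ‖ = 1) :
    (∀ O : QOp D, IsSelfAdjoint O →
      ContDiff ℝ (⊤ : ℕ∞) (landscape (N := N) H₀ H T O ψ) ∧
      ∀ (P : ℕ), 1 ≤ P → ∀ (i : Fin P → Fin M × Fin N) (u : Fin M × Fin N → ℝ),
        |mixedPartial (List.ofFn i) (landscape H₀ H T O ψ) u|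
          ≤ (ωmax * timeStep T N) ^ P * (expectationRange O / 2)) ∧
    (∀ χ : QState D, ‖χ‖ = 1 →
      (2 ≤ D → expectationRange (InnerProductSpace.rankOne ℂ χ χ) = 1) ∧
      ∀ (P : ℕ), 1 ≤ P → ∀ (i : Fin P → Fin M × Fin N) (u : Fin M × Fin N → ℝ),
        |mixedPartial (List.ofFn i) (landscape H₀ H T (InnerProductSpace.rankOne ℂ χ χ) ψ) u|
          ≤ (ωmax * timeStep T N) ^ P / 2) := by
  have : NeZero D := ⟨by
    rintro rfl
    rw [Subsingleton.elim ψ 0, norm_zero] at hψ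
    exact zero_ne_one hψ⟩
  refine ⟨fun O hO => ⟨contDiff_landscape H₀ H T O ψ, fun P hP i u =>
    abs_mixedPartial_landscape_le hH₀ hH hT hω hO hψ hP i u⟩, fun χ hχ =>
    ⟨fun hD => expectationRange_rankOne hD hχ, fun P hP i u => ?_⟩⟩
  have hO : IsSelfAdjoint (InnerProductSpace.rankOne ℂ χ χ) :=
    (InnerProductSpace.isStarProjection_rankOne_self hχ).isSelfAdjoint
  -- A coordinate exists because `1 ≤ P`; so there is a control, and `ωmax`, as its width, is `≥ 0`.
  have hω0 : 0 ≤ ωmax := by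
    obtain ⟨c, hc⟩ := exists_norm_sub_smul_one_le_spectralWidth (hH (i ⟨0, hP⟩).1)
    rw [hω] at hc
    linarith [norm_nonneg (H (i ⟨0, hP⟩).1 - (c : ℂ) • 1)]
  have hδt : 0 ≤ timeStep T N := div_nonneg hT (Nat.cast_nonneg N)
  refine (abs_mixedPartial_landscape_le hH₀ hH hT hω hO hψ hP i u).trans ?_
  rw [div_eq_mul_inv]
  refine mul_le_mul_of_nonneg_left ?_ (pow_nonneg (mul_nonneg hω0 hδt) P)
  linarith [expectationRange_rankOne_le hχ]
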